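/- Let $X$ be an infinite-dimensional separable (real or complex) Banach space. Let $\omega=(1,\frac1{2^2},\frac1{3^2},\frac1{4^2},\dots)$, let $B_\omega:\ell_1\to\ell_1$ be the weighted backward shift $[B_\omega(x)]_i=\omega_i x_{i+1}$, and let $M$ be the continuous bilinear operator $M(x,y)=y_1B_\omega(x)$ on $\ell_1$, that is, $[M(x,y)]_i=y_1\,\omega_i\,x_{i+1}$ for $i\ge 1$. Then there is a continuous bilinear operator $N:X\times X\to X$ that is quasiconjugated to $M$, i.e. there is a continuous map $\phi:\ell_1\to X$ with dense range such that $N(\phi(a),\phi(b))=\phi(M(a,b))$ for all $a,b\in\ell_1$. Moreover, the factor can be taken to be the continuous linear map $\phi(a)=\sum_{n\ge1}a_nx_n$, where $(x_n,x_n^*)_{n\ge1}\subset X\times X^*$ is a bounded Markushevich basis with $\|x_n\|=1$ for all $n$: $x_n^*(x_k)=\delta_{n,k}$, the span of $\{x_n\}$ is dense in $X$, the span of $\{x_n^*\}$ is weak-$*$ dense in $X^*$, and $\sup_n\|x_n\|\,\|x_n^*\|<\infty$. -/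

import Mathlib

open scoped ENNReal

noncomputable section

/-- The Banach space `ℓ₁` of absolutely summable scalar sequences, indexed from `0`:
the coordinate written `x_i` (`i ≥ 1`) in the usual notation is `x (i - 1)` here. -/
abbrev Ell1 (𝕜 : Type*) [RCLike 𝕜] : Type _ := lp (fun _ : ℕ => 𝕜) 1

theorem Ell1.summable_norm {𝕜 : Type*} [RCLike 𝕜] (x : Ell1 𝕜) :
    Summable fun n => ‖x n‖ := by
  simpa using (lp.memℓp x).summable (by simp)

theorem Ell1.norm_eq_tsum {𝕜 : Type*} [RCLike 𝕜] (x : Ell1 𝕜) :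
    ‖x‖ = ∑' n, ‖x n‖ := by
  simpa using lp.norm_eq_tsum_rpow (p := 1) (by simp) x

/-- The weights `ω = (1, 1/2², 1/3², …)`, indexed from `0`. -/
def omegaWeight (n : ℕ) : ℝ := 1 / ((n : ℝ) + 1) ^ 2

theorem omegaWeight_nonneg (n : ℕ) : 0 ≤ omegaWeight n := by
  unfold omegaWeight; positivity

theorem omegaWeight_le_one (n : ℕ) : omegaWeight n ≤ 1 := by
  unfold omegaWeight
  rw [div_le_one (by positivity)]
  exact one_le_pow₀ (by linarith [(Nat.cast_nonneg n : (0 : ℝ) ≤ n)])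

theorem norm_omegaWeight_mul_le {𝕜 : Type*} [RCLike 𝕜] (n : ℕ) (c : 𝕜) :
    ‖(omegaWeight n : 𝕜) * c‖ ≤ ‖c‖ := by
  rw [norm_mul, RCLike.norm_ofReal, abs_of_nonneg (omegaWeight_nonneg n)]
  exact mul_le_of_le_one_left (norm_nonneg c) (omegaWeight_le_one n)

theorem Ell1.summable_weightedShift {𝕜 : Type*} [RCLike 𝕜] (x : Ell1 𝕜) :
    Summable fun n => ‖(omegaWeight n : 𝕜) * x (n + 1)‖ :=
  Summable.of_nonneg_of_le (fun _ => norm_nonneg _)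
    (fun n => norm_omegaWeight_mul_le n (x (n + 1)))
    ((summable_nat_add_iff 1).2 x.summable_norm)

/-- The weighted backward shift `[B_ω x]_i = ω_i x_{i+1}` on `ℓ₁`. -/
def weightedBackwardShift (𝕜 : Type*) [RCLike 𝕜] : Ell1 𝕜 →L[𝕜] Ell1 𝕜 :=
  LinearMap.mkContinuous
    { toFun := fun x => ⟨fun n => (omegaWeight n : 𝕜) * x (n + 1),
        memℓp_gen (by simpa using x.summable_weightedShift)⟩
      map_add' := fun x y => by
        ext n
        exact mul_add _ _ _
      map_smul' := fun c x => by
        ext n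
        exact mul_left_comm _ _ _ }
    1 fun x => by
      rw [one_mul, Ell1.norm_eq_tsum, Ell1.norm_eq_tsum]
      refine (Summable.tsum_le_tsum (fun n => norm_omegaWeight_mul_le n (x (n + 1)))
        x.summable_weightedShift ((summable_nat_add_iff 1).2 x.summable_norm)).trans ?_
      rw [x.summable_norm.tsum_eq_zero_add]
      exact le_add_of_nonneg_left (norm_nonneg _)

/-- The continuous bilinear operator `M(x, y) = e₁'(y) B_ω(x)` on `ℓ₁`,
that is `[M(x, y)]_i = y_1 ω_i x_{i+1}`, as a continuous `2`-linear map. -/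
def shiftBilinear (𝕜 : Type*) [RCLike 𝕜] :
    ContinuousMultilinearMap 𝕜 (fun _ : Fin 2 => Ell1 𝕜) (Ell1 𝕜) where
  toFun v := lp.evalCLM 𝕜 (fun _ : ℕ => 𝕜) 1 0 (v 1) • weightedBackwardShift 𝕜 (v 0)
  map_update_add' v i x y := by
    fin_cases i <;> simp [Function.update, add_smul]
  map_update_smul' v i c x := by
    fin_cases i <;> simp [Function.update, smul_smul, mul_comm]
  cont := by fun_prop

theorem shiftBilinear_apply {𝕜 : Type*} [RCLike 𝕜] (x y : Ell1 𝕜) (n : ℕ) :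
    shiftBilinear 𝕜 ![x, y] n = y 0 * ((omegaWeight n : 𝕜) * x (n + 1)) := rfl

/-- `φ : Y → X` is a quasiconjugation factor from the `m`-linear operator `N` on `Y` to the
`m`-linear operator `L` on `X`: it is continuous, has dense range, and `L ∘ φ^m = φ ∘ N`. -/
structure IsQuasiconjugacyFactor {𝕜 X Y : Type*} [RCLike 𝕜]
    [NormedAddCommGroup X] [NormedSpace 𝕜 X] [NormedAddCommGroup Y] [NormedSpace 𝕜 Y] {m : ℕ}
    (L : ContinuousMultilinearMap 𝕜 (fun _ : Fin m => X) X)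
    (N : ContinuousMultilinearMap 𝕜 (fun _ : Fin m => Y) Y) (φ : Y → X) : Prop where
  continuous : Continuous φ
  denseRange : DenseRange φ
  comm : ∀ v : Fin m → Y, L (fun i => φ (v i)) = φ (N v)

/-- The `m`-linear operator `L` on `X` is quasiconjugated to the `m`-linear operator `N` on `Y`. -/
def IsQuasiconjugatedTo {𝕜 X Y : Type*} [RCLike 𝕜]
    [NormedAddCommGroup X] [NormedSpace 𝕜 X] [NormedAddCommGroup Y] [NormedSpace 𝕜 Y] {m : ℕ}
    (L : ContinuousMultilinearMap 𝕜 (fun _ : Fin m => X) X)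
    (N : ContinuousMultilinearMap 𝕜 (fun _ : Fin m => Y) Y) : Prop :=
  ∃ φ : Y → X, IsQuasiconjugacyFactor L N φ

/-- `(x_n, x_n^*)` is a bounded Markushevich basis of `X`: biorthogonal, the `x_n` have dense
span in `X`, the `x_n^*` have weak-star dense span in `X^*`, and `sup_n ‖x_n‖ ‖x_n^*‖ < ∞`. -/
structure IsBoundedMarkushevichBasis (𝕜 : Type*) {X : Type*} [RCLike 𝕜]
    [NormedAddCommGroup X] [NormedSpace 𝕜 X]
    (x : ℕ → X) (xs : ℕ → StrongDual 𝕜 X) : Prop where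
  dense_span : Dense (Submodule.span 𝕜 (Set.range x) : Set X)
  weakStar_dense_span :
    Dense (Submodule.span 𝕜 (Set.range fun n => StrongDual.toWeakDual (xs n)) :
      Set (WeakDual 𝕜 X))
  biorthogonal : ∀ n k, xs n (x k) = if n = k then 1 else 0
  bounded : ∃ C : ℝ, ∀ n, ‖x n‖ * ‖xs n‖ ≤ C

end

/-! Let `(x_n, x_n^*)` be a bounded Markushevich basis with unit vectors. Then `φ(a) = ∑ a_n x_n`
converges absolutely and satisfies `x_n^*(φ a) = a_n`. Since `ω` is summable and the `x_n^*` are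
bounded, `T = ∑ ω_n x_{n+1}^* ⊗ x_n` converges in operator norm, and `T φ = φ B_ω`. So `N(u, v) =
x_1^*(v) T(u)` works.

The substance is the Ovsepian–Pełczyński basis. Vectors of a dense sequence and functionals of a
separating sequence are absorbed alternately into a growing finite biorthogonal system. Each
absorption creates a pair `p` of uncontrolled norms. By `exists_biorthogonalTo_norm_le` there is
always a further pair `y` of norms at most 1 and 3, and replacing `p, y` by `(p ± y)/√2` keeps
biorthogonality and the span while lowering large norms. Iteration
(`exists_finite_bounded_replacement`) brings every norm down to 12. -/

section Biorthogonal

variable {𝕜 X : Type*} [RCLike 𝕜] [NormedAddCommGroup X] [NormedSpace 𝕜 X]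

/-! ### Biorthogonal sets of pairs -/

/-- A set of pairs `(x, f)` of vectors and functionals is biorthogonal. -/
def IsBiorthogonal (S : Set (X × StrongDual 𝕜 X)) : Prop :=
  (∀ p ∈ S, p.2 p.1 = 1) ∧ S.Pairwise fun p q => q.2 p.1 = 0

/-- The pair `p` can be added to the biorthogonal set `S`. -/
def BiorthogonalTo (p : X × StrongDual 𝕜 X) (S : Set (X × StrongDual 𝕜 X)) : Prop :=
  p.2 p.1 = 1 ∧ ∀ q ∈ S, q.2 p.1 = 0 ∧ p.2 q.1 = 0

variable {S T : Set (X × StrongDual 𝕜 X)} {p q : X × StrongDual 𝕜 X}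

theorem isBiorthogonal_empty : IsBiorthogonal (∅ : Set (X × StrongDual 𝕜 X)) := by
  simp [IsBiorthogonal]

theorem BiorthogonalTo.notMem (h : BiorthogonalTo p S) : p ∉ S := fun hp => by
  have := (h.2 p hp).2
  rw [h.1] at this
  exact one_ne_zero this

theorem IsBiorthogonal.insert_pair (hS : IsBiorthogonal S) (h : BiorthogonalTo p S) :
    IsBiorthogonal (insert p S) := by
  refine ⟨?_, ?_⟩
  · rintro q (rfl | hq)
    exacts [h.1, hS.1 q hq]
  · exact hS.2.insert fun q hq _ => h.2 q hq

theorem IsBiorthogonal.biorthogonalTo (hS : IsBiorthogonal (insert p S)) (hp : p ∉ S) :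
    BiorthogonalTo p S := by
  refine ⟨hS.1 p (Set.mem_insert _ _), fun q hq => ?_⟩
  have hne : p ≠ q := fun h => hp (h ▸ hq)
  exact ⟨hS.2 (Set.mem_insert _ _) (Set.mem_insert_of_mem _ hq) hne,
    hS.2 (Set.mem_insert_of_mem _ hq) (Set.mem_insert _ _) hne.symm⟩

theorem IsBiorthogonal.mono (hT : IsBiorthogonal T) (h : S ⊆ T) : IsBiorthogonal S :=
  ⟨fun p hp => hT.1 p (h hp), hT.2.mono h⟩

theorem IsBiorthogonal.iUnion_of_monotone {S : ℕ → Set (X × StrongDual 𝕜 X)} (hS : Monotone S)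
    (h : ∀ n, IsBiorthogonal (S n)) : IsBiorthogonal (⋃ n, S n) := by
  refine ⟨fun p hp => ?_, fun p hp q hq hpq => ?_⟩
  · obtain ⟨n, hn⟩ := Set.mem_iUnion.1 hp
    exact (h n).1 p hn
  · obtain ⟨n, hn⟩ := Set.mem_iUnion.1 hp
    obtain ⟨m, hm⟩ := Set.mem_iUnion.1 hq
    exact (h (max n m)).2 (hS (le_max_left _ _) hn) (hS (le_max_right _ _) hm) hpq

/-- The natural projection `e = ∑ r^*(d) r` onto the span of the vectors has the same coefficients
as `d`. -/
theorem IsBiorthogonal.exists_sub_apply_eq_zero (hS : IsBiorthogonal S) (hf : S.Finite) (d : X) :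
    ∃ e ∈ Submodule.span 𝕜 (Prod.fst '' S), ∀ q ∈ S, q.2 (d - e) = 0 := by
  refine ⟨∑ r ∈ hf.toFinset, r.2 d • r.1, Submodule.sum_mem _ fun r hr =>
    Submodule.smul_mem _ _ (Submodule.subset_span ⟨r, hf.mem_toFinset.1 hr, rfl⟩), fun q hq => ?_⟩
  rw [map_sub, map_sum, Finset.sum_eq_single q]
  · simp [hS.1 q hq]
  · intro r hr hrq
    simp [hS.2 (hf.mem_toFinset.1 hr) hq hrq]
  · intro h
    exact absurd (hf.mem_toFinset.2 hq) h

theorem IsBiorthogonal.exists_sub_apply_eq_zero' (hS : IsBiorthogonal S) (hf : S.Finite)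
    (f : StrongDual 𝕜 X) :
    ∃ g ∈ Submodule.span 𝕜 (Prod.snd '' S), ∀ q ∈ S, (f - g) q.1 = 0 := by
  refine ⟨∑ r ∈ hf.toFinset, f r.1 • r.2, Submodule.sum_mem _ fun r hr =>
    Submodule.smul_mem _ _ (Submodule.subset_span ⟨r, hf.mem_toFinset.1 hr, rfl⟩), fun q hq => ?_⟩
  rw [sub_apply, sum_apply, Finset.sum_eq_single q]
  · simp [hS.1 q hq]
  · intro r hr hrq
    simp [hS.2 hq (hf.mem_toFinset.1 hr) hrq.symm]
  · intro h
    exact absurd (hf.mem_toFinset.2 hq) h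

/-! ### Enlarging a finite system with controlled norms -/

/-- A vector at distance at least `r` from a closed subspace is normed, up to `1 / r`, by a
functional vanishing on the subspace. -/
theorem exists_dual_eq_one_of_le_norm_sub {E : Submodule 𝕜 X} (hE : IsClosed (E : Set X)) {x : X}
    {r : ℝ} (hr : 0 < r) (h : ∀ e ∈ E, r ≤ ‖x - e‖) :
    ∃ f : StrongDual 𝕜 X, f x = 1 ∧ (∀ e ∈ E, f e = 0) ∧ ‖f‖ ≤ 1 / r := by
  have hr' : r ≤ ‖(Submodule.Quotient.mk x : X ⧸ E)‖ := by
    refine QuotientAddGroup.le_norm_iff.2 fun m hm => ?_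
    have : x - m ∈ E := (Submodule.Quotient.eq E).1 hm.symm
    simpa using h _ this
  set y : X ⧸ E := Submodule.Quotient.mk x with hy
  have hy0 : 0 < ‖y‖ := hr.trans_le hr'
  obtain ⟨g, hg1, hg⟩ := exists_dual_vector 𝕜 y hy0.ne'
  let π : X →L[𝕜] X ⧸ E := E.mkQ.mkContinuous 1 fun m => by
    simpa using Submodule.Quotient.norm_mk_le (S := E) m
  have hπ : ‖π‖ ≤ 1 := LinearMap.mkContinuous_norm_le _ zero_le_one _
  refine ⟨((‖y‖ : 𝕜)⁻¹) • g.comp π, ?_, fun e he => ?_, ?_⟩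
  · have : g (π x) = ‖y‖ := hg
    have h0 : (‖y‖ : 𝕜) ≠ 0 := by exact_mod_cast hy0.ne'
    simp [this, h0]
  · have : π e = 0 := (Submodule.Quotient.mk_eq_zero E).2 he
    simp [this]
  · have h1 : ‖g.comp π‖ ≤ 1 := by
      refine (g.opNorm_comp_le π).trans ?_
      rw [hg1, one_mul]
      exact hπ
    rw [norm_smul, norm_inv, RCLike.norm_ofReal, abs_of_pos hy0, one_div]
    calc ‖y‖⁻¹ * ‖g.comp π‖ ≤ ‖y‖⁻¹ * 1 := by gcongr
      _ ≤ r⁻¹ := by rw [mul_one]; gcongr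

/-- Finitely many functionals norm a finite-dimensional subspace up to the factor `1 / 2`. -/
theorem exists_finite_norming (E : Submodule 𝕜 X) [FiniteDimensional 𝕜 E] :
    ∃ F : Finset (StrongDual 𝕜 X), ∀ e ∈ E, ∀ z : X, (∀ f ∈ F, f z = 0) →
      ‖e‖ ≤ 2 * ‖e + z‖ := by
  classical
  have : ProperSpace E := FiniteDimensional.proper 𝕜 E
  -- Norming functionals at a finite 1/2-net of the unit sphere of `E` suffice: each unit vector is
  -- within 1/2 of a net point `v`, so `g v` is at least `1 - 1/2` on it.
  obtain ⟨t, hts, ht, hcov⟩ := (isCompact_sphere (0 : E) 1).finite_cover_balls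
    (e := 1 / 2) (by norm_num)
  choose g hg1 hg using fun x : X => exists_dual_vector'' 𝕜 x
  refine ⟨ht.toFinset.image fun e : E => g e, fun e he z hz => ?_⟩
  rcases eq_or_ne e 0 with rfl | he0
  · simp
  have hn : 0 < ‖e‖ := norm_pos_iff.2 he0
  have hn' : (‖e‖ : 𝕜) ≠ 0 := by exact_mod_cast hn.ne'
  let u : E := (‖e‖ : 𝕜)⁻¹ • ⟨e, he⟩
  have hu1 : ‖u‖ = 1 := by
    change ‖(‖e‖ : 𝕜)⁻¹ • e‖ = 1
    rw [norm_smul, norm_inv, RCLike.norm_ofReal, abs_of_pos hn, inv_mul_cancel₀ hn.ne']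
  have hu : u ∈ Metric.sphere (0 : E) 1 := by simpa using hu1
  obtain ⟨v, hv, huv⟩ := Set.mem_iUnion₂.1 (hcov hu)
  have hdist : ‖(u : X) - v‖ < 1 / 2 := by
    have := Metric.mem_ball.1 huv
    rwa [dist_eq_norm] at this
  have hv1 : ‖(v : X)‖ = 1 := by simpa using hts hv
  have hgu : 1 / 2 ≤ ‖g v u‖ := by
    have h1 : ‖g v (u - v)‖ ≤ 1 / 2 := (((g v).le_opNorm _).trans
      (mul_le_of_le_one_left (norm_nonneg _) (hg1 v))).trans hdist.le
    have h2 : ‖g v v‖ = 1 := by rw [hg, hv1]; simp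
    have h3 : g v v = g v u - g v (u - v) := by rw [map_sub]; ring
    have h4 := norm_sub_le (g v u) (g v (u - v))
    rw [← h3, h2] at h4
    linarith
  have heu : e = (‖e‖ : 𝕜) • (u : X) := by
    change e = (‖e‖ : 𝕜) • ((‖e‖ : 𝕜)⁻¹ • e)
    rw [smul_smul, mul_inv_cancel₀ hn', one_smul]
  have hge : ‖g v e‖ = ‖e‖ * ‖g v u‖ := by
    conv_lhs => rw [heu]
    rw [map_smul, norm_smul, RCLike.norm_ofReal, abs_of_pos hn]
  have hgz : g v (e + z) = g v e := by
    rw [map_add, hz _ (Finset.mem_image_of_mem _ (ht.mem_toFinset.2 hv)), add_zero]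
  have hle : ‖g v e‖ ≤ ‖e + z‖ := by
    rw [← hgz]
    exact ((g v).le_opNorm _).trans (mul_le_of_le_one_left (norm_nonneg _) (hg1 v))
  nlinarith

/-- In an infinite-dimensional space, finitely many functionals have a common unit zero. -/
theorem exists_norm_eq_one_forall_apply_eq_zero (hX : ¬ FiniteDimensional 𝕜 X)
    (F : Finset (StrongDual 𝕜 X)) : ∃ z : X, ‖z‖ = 1 ∧ ∀ f ∈ F, f z = 0 := by
  let A : X →ₗ[𝕜] (F → 𝕜) := LinearMap.pi fun f => (f : StrongDual 𝕜 X).toLinearMap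
  have hA : LinearMap.ker A ≠ ⊥ := fun h =>
    hX (FiniteDimensional.of_injective A (LinearMap.ker_eq_bot.1 h))
  obtain ⟨z, hz, hz0⟩ := Submodule.exists_mem_ne_zero_of_ne_bot hA
  refine ⟨(‖z‖ : 𝕜)⁻¹ • z, norm_smul_inv_norm hz0, fun f hf => ?_⟩
  have : f z = 0 := congrFun (show A z = 0 from hz) ⟨f, hf⟩
  rw [map_smul, this, smul_zero]

/-- Every finite biorthogonal set can be enlarged by a pair of controlled norms. -/
theorem exists_biorthogonalTo_norm_le (hX : ¬ FiniteDimensional 𝕜 X) (hf : S.Finite) :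
    ∃ p, BiorthogonalTo p S ∧ ‖p.1‖ = 1 ∧ ‖p.2‖ ≤ 3 := by
  classical
  let E := Submodule.span 𝕜 (Prod.fst '' S)
  have : FiniteDimensional 𝕜 E := FiniteDimensional.span_of_finite 𝕜 (hf.image _)
  obtain ⟨F, hF⟩ := exists_finite_norming E
  obtain ⟨z, hz1, hz⟩ := exists_norm_eq_one_forall_apply_eq_zero hX
    (F ∪ hf.toFinset.image Prod.snd)
  -- The distance 1/3 arises from `1 = ‖z‖ ≤ ‖z - e‖ + ‖e‖ ≤ 3 ‖z - e‖`.
  obtain ⟨f, hfz, hfE, hfn⟩ := exists_dual_eq_one_of_le_norm_sub (E := E)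
    E.closed_of_finiteDimensional (x := z) (r := 1 / 3) (by norm_num) fun e he => by
      have h1 := hF (-e) (E.neg_mem he) z fun f hf => hz f (Finset.mem_union_left _ hf)
      have h2 : ‖z‖ ≤ ‖z - e‖ + ‖e‖ := by simpa using norm_add_le (z - e) e
      rw [norm_neg, neg_add_eq_sub] at h1
      linarith
  refine ⟨(z, f), ⟨hfz, fun q hq => ⟨?_, hfE _ (Submodule.subset_span ⟨q, hq, rfl⟩)⟩⟩, hz1,
    hfn.trans (by norm_num)⟩
  exact hz _ (Finset.mem_union_right _ (Finset.mem_image_of_mem _ (hf.mem_toFinset.2 hq)))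

/-! ### Reducing norms by rotation -/

/-- The two pairs that replace `p` and `y`: the half turn `(p ± y) / √2`. -/
theorem BiorthogonalTo.rotate {y : X × StrongDual 𝕜 X} (hp : BiorthogonalTo p S)
    (hy : BiorthogonalTo y (insert p S)) {c : 𝕜} (hc : c * c = 1 / 2) :
    BiorthogonalTo (c • (p - y)) S ∧
      BiorthogonalTo (c • (p + y)) (insert (c • (p - y)) S) := by
  have hpy := hy.2 p (Set.mem_insert _ _)
  have hyS := fun q hq => hy.2 q (Set.mem_insert_of_mem p hq)
  refine ⟨⟨?_, fun q hq => ⟨?_, ?_⟩⟩, ?_, ?_⟩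
  · simp [hp.1, hy.1, hpy.1, hpy.2]
    linear_combination 2 * hc
  · simp [(hp.2 q hq).1, (hyS q hq).1]
  · simp [(hp.2 q hq).2, (hyS q hq).2]
  · simp [hp.1, hy.1, hpy.1, hpy.2]
    linear_combination 2 * hc
  · rintro q (rfl | hq)
    · simp [hp.1, hy.1, hpy.1, hpy.2]
    · simp [(hp.2 q hq).1, (hyS q hq).1, (hp.2 q hq).2, (hyS q hq).2]

/-- This fixes the constant 12: `|c| = 1/√2 ≤ 3/4`, and `(3/4)(r + 4) ≤ r` exactly when `r ≥ 12`.
Adding `y` costs at most 3, so one rotation lowers the bound from `r + 1` to `r`. -/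
theorem norm_smul_le_of_two_mul_sq_eq_one {E : Type*} [SeminormedAddCommGroup E] [NormedSpace 𝕜 E]
    {c : 𝕜} (hc : c * c = 1 / 2) {r : ℝ} (hr : 12 ≤ r) {v : E} (hv : ‖v‖ ≤ r + 1 + 3) :
    ‖c • v‖ ≤ r := by
  have h1 : ‖c‖ * ‖c‖ = 1 / 2 := by rw [← norm_mul, hc]; simp
  have h2 : ‖c‖ ≤ 3 / 4 := by nlinarith [norm_nonneg c]
  rw [norm_smul]
  nlinarith [norm_nonneg c, norm_nonneg v]

theorem smul_half_turn {E : Type*} [AddCommGroup E] [Module 𝕜 E] {c : 𝕜} (hc : c * c = 1 / 2)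
    (p y : E) : c • (c • (p + y) + c • (p - y)) = p := by
  rw [← smul_add, smul_smul, hc, add_add_sub_cancel, ← two_smul 𝕜 p, smul_smul]
  norm_num

/-- An arbitrary biorthogonal pair can be traded for finitely many pairs of controlled norms. -/
theorem exists_finite_bounded_replacement (hX : ¬ FiniteDimensional 𝕜 X) (n : ℕ)
    (hf : S.Finite) (hS : IsBiorthogonal S) (hp : BiorthogonalTo p S)
    (hp1 : ‖p.1‖ ≤ 12 + n) (hp2 : ‖p.2‖ ≤ 12 + n) :
    ∃ T : Set (X × StrongDual 𝕜 X), T.Finite ∧ Disjoint S T ∧ IsBiorthogonal (S ∪ T) ∧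
      (∀ q ∈ T, ‖q.1‖ ≤ 12 ∧ ‖q.2‖ ≤ 12) ∧ p ∈ Submodule.span 𝕜 T := by
  induction n generalizing S p with
  | zero =>
    refine ⟨{p}, Set.finite_singleton p, by simpa using hp.notMem, ?_, ?_,
      Submodule.subset_span rfl⟩
    · rw [Set.union_singleton]
      exact hS.insert_pair hp
    · rintro q rfl
      simpa using And.intro hp1 hp2
  | succ n ih =>
    obtain ⟨c, hc⟩ : ∃ c : 𝕜, c * c = 1 / 2 := by
      refine ⟨((√(1 / 2) : ℝ) : 𝕜), ?_⟩
      rw [← RCLike.ofReal_mul, Real.mul_self_sqrt (by norm_num)]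
      push_cast
      rfl
    obtain ⟨y, hy, hy1, hy2⟩ := exists_biorthogonalTo_norm_le hX (hf.insert p)
    obtain ⟨hm, ha⟩ := hp.rotate hy hc
    have hr : (12 : ℝ) ≤ 12 + n := by simp
    push_cast at hp1 hp2
    obtain ⟨T₁, hT₁, hd₁, hb₁, hn₁, hs₁⟩ := ih (hf.insert _) (hS.insert_pair hm) ha
      (norm_smul_le_of_two_mul_sq_eq_one hc hr ((norm_add_le p.1 y.1).trans (by linarith)))
      (norm_smul_le_of_two_mul_sq_eq_one hc hr ((norm_add_le p.2 y.2).trans (by linarith)))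
    rw [Set.disjoint_insert_left] at hd₁
    rw [Set.insert_union] at hb₁
    -- `T₁` was built with the minus pair already in the base system, so that pair is still
    -- biorthogonal to `S ∪ T₁` and can be replaced in turn.
    obtain ⟨T₂, hT₂, hd₂, hb₂, hn₂, hs₂⟩ := ih (hf.union hT₁) (hb₁.mono (Set.subset_insert _ _))
      (hb₁.biorthogonalTo fun h => h.elim hm.notMem hd₁.1)
      (norm_smul_le_of_two_mul_sq_eq_one hc hr ((norm_sub_le p.1 y.1).trans (by linarith)))
      (norm_smul_le_of_two_mul_sq_eq_one hc hr ((norm_sub_le p.2 y.2).trans (by linarith)))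
    rw [Set.disjoint_union_left] at hd₂
    refine ⟨T₁ ∪ T₂, hT₁.union hT₂, Set.disjoint_union_right.2 ⟨hd₁.2, hd₂.1⟩, ?_, ?_, ?_⟩
    · rwa [← Set.union_assoc]
    · rintro q (hq | hq)
      exacts [hn₁ q hq, hn₂ q hq]
    · have h1 := Submodule.span_mono (R := 𝕜) (Set.subset_union_left (s := T₁) (t := T₂)) hs₁
      have h2 := Submodule.span_mono (R := 𝕜) (Set.subset_union_right (s := T₁) (t := T₂)) hs₂
      rw [← smul_half_turn hc p y]
      exact Submodule.smul_mem _ _ (Submodule.add_mem _ h1 h2)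

theorem fst_mem_span_image (h : p ∈ Submodule.span 𝕜 T) :
    p.1 ∈ Submodule.span 𝕜 (Prod.fst '' T) := by
  have := Submodule.mem_map_of_mem (f := LinearMap.fst 𝕜 X (StrongDual 𝕜 X)) h
  rwa [Submodule.map_span] at this

theorem snd_mem_span_image (h : p ∈ Submodule.span 𝕜 T) :
    p.2 ∈ Submodule.span 𝕜 (Prod.snd '' T) := by
  have := Submodule.mem_map_of_mem (f := LinearMap.snd 𝕜 X (StrongDual 𝕜 X)) h
  rwa [Submodule.map_span] at this

/-! ### Absorbing a given vector or functional -/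

/-- A finite biorthogonal set of pairs of norms at most `12`. -/
structure IsGoodBiorthogonal (S : Set (X × StrongDual 𝕜 X)) : Prop where
  finite : S.Finite
  isBiorthogonal : IsBiorthogonal S
  norm_le : ∀ q ∈ S, ‖q.1‖ ≤ 12 ∧ ‖q.2‖ ≤ 12

theorem IsGoodBiorthogonal.exists_superset (hX : ¬ FiniteDimensional 𝕜 X)
    (hS : IsGoodBiorthogonal S) (hp : BiorthogonalTo p S) :
    ∃ T, S ⊆ T ∧ IsGoodBiorthogonal T ∧ p ∈ Submodule.span 𝕜 T := by
  obtain ⟨n, hn⟩ := exists_nat_ge (max ‖p.1‖ ‖p.2‖)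
  have h1 := (le_max_left _ _).trans hn
  have h2 := (le_max_right _ _).trans hn
  obtain ⟨T, hT, -, hb, hn, hs⟩ := exists_finite_bounded_replacement hX n hS.finite
    hS.isBiorthogonal hp (by linarith) (by linarith)
  refine ⟨S ∪ T, Set.subset_union_left, ⟨hS.finite.union hT, hb, ?_⟩,
    Submodule.span_mono Set.subset_union_right hs⟩
  rintro q (hq | hq)
  exacts [hS.norm_le q hq, hn q hq]

theorem IsGoodBiorthogonal.exists_superset_fst (hX : ¬ FiniteDimensional 𝕜 X)
    (hS : IsGoodBiorthogonal S) (d : X) :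
    ∃ T, S ⊆ T ∧ IsGoodBiorthogonal T ∧ d ∈ Submodule.span 𝕜 (Prod.fst '' T) := by
  by_cases hd : d ∈ Submodule.span 𝕜 (Prod.fst '' S)
  · exact ⟨S, subset_rfl, hS, hd⟩
  obtain ⟨e, he, hed⟩ := hS.isBiorthogonal.exists_sub_apply_eq_zero hS.finite d
  let E := Submodule.span 𝕜 (Prod.fst '' S)
  have : FiniteDimensional 𝕜 E := FiniteDimensional.span_of_finite 𝕜 (hS.finite.image _)
  have hE : IsClosed (E : Set X) := E.closed_of_finiteDimensional
  have hx : d - e ∉ E := fun h => hd ((Submodule.sub_mem_iff_left _ he).1 h)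
  have hpos := (hE.notMem_iff_infDist_pos ⟨0, E.zero_mem⟩).1 hx
  -- The norm of `f` is irrelevant: the replacement step accepts any pair.
  obtain ⟨f, hf1, hfE, -⟩ := exists_dual_eq_one_of_le_norm_sub hE hpos fun a ha => by
    rw [← dist_eq_norm]
    exact Metric.infDist_le_dist_of_mem ha
  obtain ⟨T, hST, hT, hs⟩ := hS.exists_superset (p := (d - e, f)) hX
    ⟨hf1, fun q hq => ⟨hed q hq, hfE _ (Submodule.subset_span ⟨q, hq, rfl⟩)⟩⟩
  refine ⟨T, hST, hT, ?_⟩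
  exact (Submodule.sub_mem_iff_left _ (Submodule.span_mono (Set.image_mono hST) he)).1
    (fst_mem_span_image hs)

theorem IsGoodBiorthogonal.exists_superset_snd (hX : ¬ FiniteDimensional 𝕜 X)
    (hS : IsGoodBiorthogonal S) (f : StrongDual 𝕜 X) :
    ∃ T, S ⊆ T ∧ IsGoodBiorthogonal T ∧ f ∈ Submodule.span 𝕜 (Prod.snd '' T) := by
  obtain ⟨g, hg, hgf⟩ := hS.isBiorthogonal.exists_sub_apply_eq_zero' hS.finite f
  by_cases h0 : f - g = 0
  · exact ⟨S, subset_rfl, hS, by rwa [sub_eq_zero.1 h0]⟩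
  obtain ⟨z, hz⟩ : ∃ z, (f - g) z ≠ 0 := by
    by_contra! h
    exact h0 (ContinuousLinearMap.ext h)
  -- Subtracting the projection `e` makes the existing functionals vanish, and leaves the value of
  -- `f - g` at 1 because `f - g` kills the span of the existing vectors.
  obtain ⟨e, he, hez⟩ := hS.isBiorthogonal.exists_sub_apply_eq_zero hS.finite
    (((f - g) z)⁻¹ • z)
  have hge : (f - g) e = 0 := by
    have : Submodule.span 𝕜 (Prod.fst '' S) ≤ LinearMap.ker (f - g).toLinearMap := by
      rw [Submodule.span_le]
      rintro _ ⟨q, hq, rfl⟩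
      exact hgf q hq
    exact this he
  obtain ⟨T, hST, hT, hs⟩ := hS.exists_superset (p := (((f - g) z)⁻¹ • z - e, f - g)) hX
    ⟨by simp only [map_sub, map_smul, hge, smul_eq_mul, sub_zero]; exact inv_mul_cancel₀ hz,
      fun q hq => ⟨hez q hq, hgf q hq⟩⟩
  refine ⟨T, hST, hT, ?_⟩
  exact (Submodule.sub_mem_iff_left _ (Submodule.span_mono (Set.image_mono hST) hg)).1
    (snd_mem_span_image hs)

end Biorthogonal

/-! ### Density, separation and the Markushevich basis -/

section Markushevich

variable {𝕜 X : Type*} [RCLike 𝕜] [NormedAddCommGroup X] [NormedSpace 𝕜 X]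

/-- A separating subspace of the dual is weak-star dense. -/
theorem dense_span_toWeakDual_of_separating {ι : Type*} (f : ι → StrongDual 𝕜 X)
    (h : ∀ x, (∀ i, f i x = 0) → x = 0) :
    Dense (Submodule.span 𝕜 (Set.range fun i => StrongDual.toWeakDual (f i)) :
      Set (WeakDual 𝕜 X)) := by
  classical
  set W := Submodule.span 𝕜 (Set.range fun i => StrongDual.toWeakDual (f i)) with hW
  have key : ∀ (g : WeakDual 𝕜 X) (I : Finset X), ∃ w ∈ W, ∀ x ∈ I, w x = g x := by
    intro g I
    let A : WeakDual 𝕜 X →ₗ[𝕜] (I → 𝕜) :=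
      { toFun := fun w x => w x
        map_add' := fun _ _ => rfl
        map_smul' := fun _ _ => rfl }
    by_cases hg : A g ∈ W.map A
    · obtain ⟨w, hw, hwg⟩ := hg
      exact ⟨w, hw, fun x hx => congrFun hwg ⟨x, hx⟩⟩
    -- A functional separating `A g` from `A W` is, composed with `A`, evaluation at one vector of
    -- `X`. All `f i` vanish there, so that vector is 0.
    · obtain ⟨c, hc, hle⟩ := Submodule.exists_le_ker_of_notMem hg
      exfalso
      have hcA : ∀ w : WeakDual 𝕜 X, c (A w) = w (∑ x : I, c (Pi.single x 1) • (x : X)) := by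
        intro w
        rw [LinearMap.pi_apply_eq_sum_univ c (A w), map_sum]
        refine Finset.sum_congr rfl fun x _ => ?_
        rw [map_smul, smul_eq_mul, smul_eq_mul, mul_comm]
        congr 2
        ext y
        simp [Pi.single_apply, eq_comm]
      apply hc
      rw [hcA, h (∑ x : I, c (Pi.single x 1) • (x : X)), map_zero]
      intro i
      have := hle (Submodule.mem_map_of_mem (f := A) (p := W)
        (Submodule.subset_span (Set.mem_range_self i)))
      rw [LinearMap.mem_ker, hcA] at this
      exact this
  intro g
  choose w hwW hw using key g
  refine mem_closure_of_tendsto (f := w) (b := Filter.atTop) ?_ (Filter.Eventually.of_forall hwW)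
  refine tendsto_iff_forall_eval_tendsto_topDualPairing.2 fun x => ?_
  refine tendsto_nhds_of_eventually_eq ((Filter.eventually_ge_atTop {x}).mono fun I hI => ?_)
  exact hw I x (hI (Finset.mem_singleton_self x))

/-- A countable family of functionals separates the points of a separable space. -/
theorem exists_seq_dual_separating [TopologicalSpace.SeparableSpace X] :
    ∃ f : ℕ → StrongDual 𝕜 X, ∀ x, (∀ n, f n x = 0) → x = 0 := by
  obtain ⟨d, hd⟩ := TopologicalSpace.exists_dense_seq X
  choose g hg1 hg using fun x : X => exists_dual_vector'' 𝕜 x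
  refine ⟨fun n => g (d n), fun x hx => ?_⟩
  by_contra h0
  have hpos : 0 < ‖x‖ / 2 := half_pos (norm_pos_iff.2 h0)
  obtain ⟨n, hn⟩ := hd.exists_dist_lt x hpos
  rw [dist_comm, dist_eq_norm] at hn
  -- If all functionals vanish at `x`, then `‖d n‖ ≤ ‖d n - x‖ < ‖x‖ / 2`, contradicting the
  -- triangle inequality.
  have h1 : ‖g (d n) (d n - x)‖ ≤ ‖d n - x‖ :=
    ((g _).le_opNorm _).trans (mul_le_of_le_one_left (norm_nonneg _) (hg1 _))
  rw [map_sub, hx n, sub_zero, hg, RCLike.norm_ofReal, abs_norm] at h1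
  have h2 := norm_sub_norm_le x (d n)
  rw [norm_sub_rev] at h2
  linarith

theorem exists_seq_isGoodBiorthogonal (hX : ¬ FiniteDimensional 𝕜 X) (d : ℕ → X)
    (f : ℕ → StrongDual 𝕜 X) :
    ∃ S : ℕ → Set (X × StrongDual 𝕜 X), Monotone S ∧ (∀ n, IsGoodBiorthogonal (S n)) ∧
      ∀ n, d n ∈ Submodule.span 𝕜 (Prod.fst '' S (n + 1)) ∧
        f n ∈ Submodule.span 𝕜 (Prod.snd '' S (n + 1)) := by
  have step : ∀ (n : ℕ) (S : {S : Set (X × StrongDual 𝕜 X) // IsGoodBiorthogonal S}),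
      ∃ T : {S : Set (X × StrongDual 𝕜 X) // IsGoodBiorthogonal S}, S.1 ⊆ T.1 ∧
        d n ∈ Submodule.span 𝕜 (Prod.fst '' T.1) ∧
        f n ∈ Submodule.span 𝕜 (Prod.snd '' T.1) := by
    rintro n ⟨S, hS⟩
    obtain ⟨T, hST, hT, hdT⟩ := hS.exists_superset_fst hX (d n)
    obtain ⟨R, hTR, hR, hfR⟩ := hT.exists_superset_snd hX (f n)
    exact ⟨⟨R, hR⟩, hST.trans hTR, Submodule.span_mono (Set.image_mono hTR) hdT, hfR⟩
  choose next hnext using step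
  let S : ℕ → {S : Set (X × StrongDual 𝕜 X) // IsGoodBiorthogonal S} := fun n =>
    Nat.rec ⟨∅, Set.finite_empty, isBiorthogonal_empty, by simp⟩ next n
  exact ⟨fun n => (S n).1, monotone_nat_of_le_succ fun n => (hnext n (S n)).1,
    fun n => (S n).2, fun n => (hnext n (S n)).2⟩

/-- **Ovsepian–Pełczyński**: a separable infinite-dimensional normed space has a bounded
Markushevich basis of unit vectors. -/
theorem exists_isBoundedMarkushevichBasis [TopologicalSpace.SeparableSpace X]
    (hX : ¬ FiniteDimensional 𝕜 X) :
    ∃ (x : ℕ → X) (xs : ℕ → StrongDual 𝕜 X),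
      IsBoundedMarkushevichBasis 𝕜 x xs ∧ ∀ n, ‖x n‖ = 1 := by
  obtain ⟨d, hd⟩ := TopologicalSpace.exists_dense_seq X
  obtain ⟨f, hf⟩ := exists_seq_dual_separating (𝕜 := 𝕜) (X := X)
  obtain ⟨S, hmono, hS, hdf⟩ := exists_seq_isGoodBiorthogonal hX d f
  set U := ⋃ n, S n with hU
  have hbio : IsBiorthogonal U :=
    IsBiorthogonal.iUnion_of_monotone hmono fun n => (hS n).isBiorthogonal
  have hbound : ∀ q ∈ U, ‖q.1‖ ≤ 12 ∧ ‖q.2‖ ≤ 12 := fun q hq => by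
    obtain ⟨n, hn⟩ := Set.mem_iUnion.1 hq
    exact (hS n).norm_le q hn
  have hSU : ∀ n, S n ⊆ U := Set.subset_iUnion S
  have hdense : Dense (Submodule.span 𝕜 (Prod.fst '' U) : Set X) :=
    hd.mono (Set.range_subset_iff.2 fun n =>
      Submodule.span_mono (Set.image_mono (hSU (n + 1))) (hdf n).1)
  have hsep : ∀ z, (∀ q ∈ U, q.2 z = 0) → z = 0 := fun z hz => hf z fun n => by
    have : Submodule.span 𝕜 (Prod.snd '' S (n + 1)) ≤
        LinearMap.ker (ContinuousLinearMap.apply 𝕜 𝕜 z).toLinearMap := by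
      rw [Submodule.span_le]
      rintro _ ⟨q, hq, rfl⟩
      exact hz q (hSU _ hq)
    exact this (hdf n).2
  have hcount : U.Countable := Set.countable_iUnion fun n => (hS n).finite.countable
  have hinf : U.Infinite := fun hfin => by
    have : FiniteDimensional 𝕜 (Submodule.span 𝕜 (Prod.fst '' U)) :=
      FiniteDimensional.span_of_finite 𝕜 (hfin.image _)
    have htop : Submodule.span 𝕜 (Prod.fst '' U) = ⊤ := by
      rw [← SetLike.coe_set_eq, Submodule.top_coe,
        ← (Submodule.closed_of_finiteDimensional _).closure_eq, hdense.closure_eq]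
    rw [htop] at this
    exact hX (Module.Finite.equiv (Submodule.topEquiv (R := 𝕜) (M := X)))
  have := hcount.to_subtype
  have := hinf.to_subtype
  obtain ⟨_⟩ := nonempty_denumerable U
  let e : ℕ ≃ U := (Denumerable.eqv U).symm
  let u : ℕ → X := fun n => (e n).1.1
  let g : ℕ → StrongDual 𝕜 X := fun n => (e n).1.2
  have hgu : ∀ n k, g n (u k) = if n = k then 1 else 0 := fun n k => by
    split_ifs with h
    · rw [h]
      exact hbio.1 _ (e k).2
    · exact hbio.2 (e k).2 (e n).2 fun h' => h (e.injective (Subtype.ext h'.symm))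
  have hu0 : ∀ n, u n ≠ 0 := fun n h => by
    have := hgu n n
    simp [h] at this
  have hn0 : ∀ n, (‖u n‖ : 𝕜) ≠ 0 := fun n => by exact_mod_cast norm_ne_zero_iff.2 (hu0 n)
  have hunit : ∀ n, ‖(‖u n‖ : 𝕜)⁻¹ • u n‖ = 1 := fun n => norm_smul_inv_norm (hu0 n)
  -- Reciprocal scaling preserves biorthogonality and both spans; the dual norms become at most `12
  -- * 12`.
  refine ⟨fun n => (‖u n‖ : 𝕜)⁻¹ • u n, fun n => (‖u n‖ : 𝕜) • g n, ⟨?_, ?_, ?_, ?_⟩, hunit⟩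
  · refine hdense.mono (SetLike.coe_subset_coe.2 (Submodule.span_le.2 ?_))
    rintro _ ⟨q, hq, rfl⟩
    have hq' : q.1 = (‖u (e.symm ⟨q, hq⟩)‖ : 𝕜) •
        ((‖u (e.symm ⟨q, hq⟩)‖ : 𝕜)⁻¹ • u (e.symm ⟨q, hq⟩)) := by
      rw [smul_smul, mul_inv_cancel₀ (hn0 _), one_smul]
      simp [u]
    rw [hq']
    exact Submodule.smul_mem _ _ (Submodule.subset_span (Set.mem_range_self _))
  · refine dense_span_toWeakDual_of_separating _ fun z hz => hsep z fun q hq => ?_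
    have h1 : (‖u (e.symm ⟨q, hq⟩)‖ : 𝕜) * g (e.symm ⟨q, hq⟩) z = 0 := hz (e.symm ⟨q, hq⟩)
    have h2 := (mul_eq_zero.1 h1).resolve_left (hn0 _)
    simpa [g] using h2
  · intro n k
    change (‖u n‖ : 𝕜) * g n ((‖u k‖ : 𝕜)⁻¹ • u k) = _
    rw [map_smul, hgu, smul_eq_mul]
    split_ifs with h
    · rw [h, mul_one, mul_inv_cancel₀ (hn0 _)]
    · simp
  · refine ⟨12 * 12, fun n => ?_⟩
    have := hbound _ (e n).2
    rw [hunit, one_mul, norm_smul, RCLike.norm_ofReal, abs_norm]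
    exact mul_le_mul this.1 this.2 (norm_nonneg _) (by norm_num)

end Markushevich

/-! ### The factor map and the bilinear operator -/

section Factor

variable {𝕜 X : Type*} [RCLike 𝕜] [NormedAddCommGroup X] [NormedSpace 𝕜 X]

theorem summable_omegaWeight : Summable omegaWeight := by
  have := (summable_nat_add_iff 1).2 (Real.summable_one_div_nat_pow.2 one_lt_two)
  exact this.congr fun n => by simp [omegaWeight]

/-- The synthesis operator `a ↦ ∑ a_n x_n` of a sequence of unit vectors. -/
theorem exists_synthesis [CompleteSpace X] {x : ℕ → X} (hx : ∀ n, ‖x n‖ = 1) :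
    ∃ φ : Ell1 𝕜 →L[𝕜] X, ∀ a : Ell1 𝕜, HasSum (fun n => a n • x n) (φ a) := by
  have hn : ∀ (a : Ell1 𝕜) n, ‖a n • x n‖ = ‖a n‖ := fun a n => by
    rw [norm_smul, hx, mul_one]
  have hs : ∀ a : Ell1 𝕜, Summable fun n => a n • x n := fun a =>
    Summable.of_norm (by simpa only [hn] using a.summable_norm)
  let φ : Ell1 𝕜 →ₗ[𝕜] X :=
    { toFun := fun a => ∑' n, a n • x n
      map_add' := fun a b => by
        rw [← (hs a).tsum_add (hs b)]
        exact tsum_congr fun n => add_smul _ _ _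
      map_smul' := fun c a => by
        rw [RingHom.id_apply, ← (hs a).tsum_const_smul c]
        exact tsum_congr fun n => mul_smul _ _ _ }
  refine ⟨φ.mkContinuous 1 fun a => ?_, fun a => (hs a).hasSum⟩
  rw [one_mul, Ell1.norm_eq_tsum]
  refine (norm_tsum_le_tsum_norm ?_).trans_eq (tsum_congr (hn a))
  simpa only [hn] using a.summable_norm

/-- The operator `∑ ω_n f_{n+1} ⊗ x_n` for a bounded sequence of functionals `f`. -/
theorem exists_weightedShift [CompleteSpace X] {x : ℕ → X} (hx : ∀ n, ‖x n‖ = 1) {f : ℕ → StrongDual 𝕜 X} {C : ℝ}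
    (hf : ∀ n, ‖f n‖ ≤ C) :
    ∃ T : X →L[𝕜] X, ∀ z, HasSum (fun n => ((omegaWeight n : 𝕜) * f (n + 1) z) • x n) (T z) := by
  let R : ℕ → X →L[𝕜] X := fun n =>
    ((omegaWeight n : 𝕜) • f (n + 1)).smulRight (x n)
  have hR : Summable R := by
    refine Summable.of_norm_bounded (summable_omegaWeight.mul_right C) fun n => ?_
    rw [ContinuousLinearMap.norm_smulRight_apply, hx, mul_one, norm_smul, RCLike.norm_ofReal,
      abs_of_nonneg (omegaWeight_nonneg n)]
    exact mul_le_mul_of_nonneg_left (hf _) (omegaWeight_nonneg n)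
  refine ⟨∑' n, R n, fun z => ?_⟩
  exact hR.hasSum.mapL (ContinuousLinearMap.apply 𝕜 X z)

/-- The bilinear operator `(u, v) ↦ g(v) T(u)`. -/
def ContinuousLinearMap.smulBilinear (g : StrongDual 𝕜 X) (T : X →L[𝕜] X) :
    ContinuousMultilinearMap 𝕜 (fun _ : Fin 2 => X) X where
  toFun v := g (v 1) • T (v 0)
  map_update_add' v i x y := by
    fin_cases i <;> simp [Function.update, add_smul]
  map_update_smul' v i c x := by
    fin_cases i <;> simp [Function.update, smul_smul, mul_comm]
  cont := by fun_prop

end Factor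

theorem mainTheorem6 {𝕜 : Type*} [RCLike 𝕜] {X : Type*} [NormedAddCommGroup X]
    [NormedSpace 𝕜 X] [CompleteSpace X] [TopologicalSpace.SeparableSpace X]
    (hX : ¬ FiniteDimensional 𝕜 X) :
    ∃ N : ContinuousMultilinearMap 𝕜 (fun _ : Fin 2 => X) X,
      IsQuasiconjugatedTo N (shiftBilinear 𝕜) ∧
      ∃ (x : ℕ → X) (xs : ℕ → StrongDual 𝕜 X) (φ : Ell1 𝕜 →L[𝕜] X),
        IsBoundedMarkushevichBasis 𝕜 x xs ∧ (∀ n, ‖x n‖ = 1) ∧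
        (∀ a : Ell1 𝕜, HasSum (fun n => a n • x n) (φ a)) ∧
        IsQuasiconjugacyFactor N (shiftBilinear 𝕜) φ := by
  obtain ⟨x, xs, hM, hx⟩ := exists_isBoundedMarkushevichBasis hX
  obtain ⟨φ, hφ⟩ := exists_synthesis (𝕜 := 𝕜) hx
  obtain ⟨C, hC⟩ := hM.bounded
  obtain ⟨T, hT⟩ := exists_weightedShift hx (f := xs) (C := C) fun n => by
    simpa [hx n] using hC n
  have hcoord : ∀ (a : Ell1 𝕜) n, xs n (φ a) = a n := fun a n => by
    have h1 := (hφ a).mapL (xs n)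
    have h2 := hasSum_single (f := fun k => xs n (a k • x k)) n fun k hk => by
      simp [hM.biorthogonal, hk.symm]
    rw [h1.unique h2, map_smul, hM.biorthogonal, if_pos rfl, smul_eq_mul, mul_one]
  have hfac : IsQuasiconjugacyFactor ((xs 0).smulBilinear T) (shiftBilinear 𝕜) φ := by
    refine ⟨φ.continuous, ?_, fun v => ?_⟩
    · have hle : Submodule.span 𝕜 (Set.range x) ≤ LinearMap.range φ.toLinearMap := by
        rw [Submodule.span_le]
        rintro _ ⟨n, rfl⟩
        refine ⟨lp.single 1 n (1 : 𝕜), (hφ _).unique ?_⟩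
        have h := hasSum_single (f := fun k => (lp.single 1 n (1 : 𝕜) : Ell1 𝕜) k • x k) n
          fun k hk => by simp [lp.single_apply, hk]
        simpa using h
      exact hM.dense_span.mono hle
    -- Both sides are sums of series in the `x n`, whose coefficients agree by `hcoord`.
    · have h1 := (hT (φ (v 0))).const_smul (xs 0 (φ (v 1)))
      refine h1.unique ?_
      convert hφ (shiftBilinear 𝕜 v) using 2 with n
      rw [hcoord, hcoord, smul_smul]
      rfl
  exact ⟨_, ⟨φ, hfac⟩, x, xs, φ, hM, hx, hφ, hfac⟩
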